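/- Let $\Omega$ be a non-empty set, $\mathcal{E}\subseteq\wp(\Omega)$ a non-empty family of events and $N:\mathcal{E}\to[0,1]$ an arbitrary function (a necessity assessment). Notation. For $\mathcal{G}\subseteq\wp(\Omega)$ non-empty, $\mathcal{A}_{\mathcal{G}}$ is the smallest algebra of subsets of $\Omega$ containing $\mathcal{G}$, and $\mathcal{U}_{\mathcal{G}}=\mathcal{A}_{\mathcal{G}}\setminus\{\emptyset\}$. For $A\in\mathcal{A}_{\mathcal{E}}$ put $\tilde A=\{B\in\mathcal{U}_{\mathcal{E}} : B\subseteq A\}$, and let $\mathbb{A}_{\mathcal{E}}$ be the algebra of subsets of $\mathcal{U}_{\mathcal{E}}$ generated by $\{\tilde A : A\in\mathcal{U}_{\mathcal{E}}\}$. For $B\neq\emptyset$, $\min_{\omega\in B}\mathbf{1}_E(\omega)$ equals $1$ if $B\subseteq E$ and $0$ otherwise. A finitely minitive necessity measure on an algebra $\mathcal{A}$ is a map $N':\mathcal{A}\to[0,1]$ with $N'(\emptyset)=0$, $N'(\Omega)=1$ and $N'(A\cap B)=\min\{N'(A),N'(B)\}$ for all $A,B\in\mathcal{A}$. The integral of a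 bounded function with respect to a finitely additive probability on an algebra is the Stieltjes integral: the common value of the supremum of the lower sums and the infimum of the upper sums over finite partitions into members of the algebra. If $\mathcal{F}$ is a finite non-empty set of events and $C_1,\dots,C_m$ are the atoms of the finite algebra $\mathcal{A}_{\mathcal{F}}$ (the members of the finest partition of $\Omega$ contained in it), then $\mathbf{chains}(\mathcal{U}_{\mathcal{F}})$ is the collection of all families $\{D_1,\dots,D_m\}$ with $D_k=C_{i_1}\cup\dots\cup C_{i_k}$ for $k=1,\dots,m$, where $(i_1,\dots,i_m)$ is a permutation of $(1,\dots,m)$. Then the following statements are equivalent. (i) (Coherence-1N) There is a finitely minitive necessity measure $N'$ on $\mathcal{A}_{\mathcal{E}}$ with $N'(E)=N(E)$ for every $E\in\mathcal{E}$. (ii) (Coherence-2N) There is a finitely additive probability $\mu:\mathbb{A}_{\mathcal{E}}\to[0,1]$ such that $A\mapsto\mu(\tilde A)$ is a finitely minitive necessity measure on $\mathcal{A}_{\mathcal{E}}$ and, for every $E\in\mathcal{E}$, $$N(E)=\int_{\mathcal{U}_{\mathcal{E}}}\Bigl(\min_{\omega\in B}\mathbf{1}_E(\omega)\Bigr)\,\mu(\mathrm{d}B).$$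 (iii) (Coherence-3N) For every finite non-empty $\mathcal{F}=\{E_1,\dots,E_n\}\subseteq\mathcal{E}$ there is $\mathcal{D}\in\mathbf{chains}(\mathcal{U}_{\mathcal{F}})$ such that there are real numbers $x_D\ge 0$, $D\in\mathcal{D}$, with $\sum_{D\in\mathcal{D}}x_D=1$ and $\sum_{D\in\mathcal{D}}\bigl(\min_{\omega\in D}\mathbf{1}_{E_i}(\omega)\bigr)x_D=N(E_i)$ for $i=1,\dots,n$. (iv) (Coherence-4N) For every finite non-empty $\mathcal{F}=\{E_1,\dots,E_n\}\subseteq\mathcal{E}$ there is $\mathcal{D}\in\mathbf{chains}(\mathcal{U}_{\mathcal{F}})$ such that, for all $\lambda_1,\dots,\lambda_n\in\mathbb{R}$, $$\max_{D\in\mathcal{D}}\ \sum_{i=1}^n\lambda_i\Bigl(\min_{\omega\in D}\mathbf{1}_{E_i}(\omega)-N(E_i)\Bigr)\ \ge\ 0.$$ (v) (Coherence-5N) For every finite non-empty $\mathcal{F}=\{E_1,\dots,E_n\}\subseteq\mathcal{E}$ there is $\mathcal{D}\in\mathbf{chains}(\mathcal{U}_{\mathcal{F}})$ such that there is no function $N^*:\mathcal{F}\to[0,1]$,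 distinct from the restriction of $N$ to $\mathcal{F}$, satisfying, for every $D\in\mathcal{D}$, $$\sum_{i=1}^n\Bigl(\min_{\omega\in D}\mathbf{1}_{E_i}(\omega)-N^*(E_i)\Bigr)^2<\sum_{i=1}^n\Bigl(\min_{\omega\in D}\mathbf{1}_{E_i}(\omega)-N(E_i)\Bigr)^2.$$ -/

import Mathlib

noncomputable section

namespace NecessityCoherence

/-- The algebra of subsets generated by a family of subsets of `Ω`, i.e. the smallest one
containing it. -/
abbrev algebra {Ω : Type*} (𝒢 : Set (Set Ω)) : Set (Set Ω) :=
  MeasureTheory.generateSetAlgebra 𝒢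

/-- `𝒰 = 𝒜 ∖ {∅}`: the non-impossible events of the algebra `𝒜`. -/
def nonimpossible {Ω : Type*} (𝒜 : Set (Set Ω)) : Set (Set Ω) :=
  𝒜 \ {∅}

/-- `Ã = {B ∈ 𝒰 : B ⊆ A}`, a subset of `𝒰 = 𝒜 ∖ {∅}`. -/
def tilde {Ω : Type*} (𝒜 : Set (Set Ω)) (A : Set Ω) : Set (nonimpossible 𝒜) :=
  {B | (B : Set Ω) ⊆ A}

/-- The algebra of subsets of `𝒰 = 𝒜 ∖ {∅}` generated by the sets `Ã`, for `A ∈ 𝒰`. -/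
def tildeAlgebra {Ω : Type*} (𝒜 : Set (Set Ω)) : Set (Set (nonimpossible 𝒜)) :=
  algebra (tilde 𝒜 '' nonimpossible 𝒜)

open Classical in
/-- The generalized indicator `min_{ω ∈ B} 1_E(ω)`, for a non-empty event `B`: it is `1` if
`B ⊆ E` and `0` otherwise (see `isLeast_minInd`). -/
def minInd {Ω : Type*} (B E : Set Ω) : ℝ :=
  if B ⊆ E then 1 else 0

theorem isLeast_minInd {Ω : Type*} (B E : Set Ω) (hB : B.Nonempty) :
    IsLeast (E.indicator (fun _ => (1 : ℝ)) '' B) (minInd B E) := by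
  classical
  unfold minInd
  split_ifs with h
  · obtain ⟨ω, hω⟩ := hB
    refine ⟨⟨ω, hω, by simp [h hω]⟩, ?_⟩
    rintro _ ⟨x, hx, rfl⟩
    simp [h hx]
  · obtain ⟨ω, hω, hωE⟩ := Set.not_subset.mp h
    refine ⟨⟨ω, hω, by simp [hωE]⟩, ?_⟩
    rintro _ ⟨x, -, rfl⟩
    exact Set.indicator_nonneg (fun _ _ => zero_le_one) x

/-- `μ : 𝔄 → [0,1]` is a finitely additive probability on the algebra `𝔄` of subsets of `X`.
A function on `𝔄` is represented by a function on all subsets whose values outside `𝔄` are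
irrelevant. -/
structure IsFinAddProb {X : Type*} (𝔄 : Set (Set X)) (μ : Set X → ℝ) : Prop where
  mem_Icc : ∀ S ∈ 𝔄, μ S ∈ Set.Icc (0 : ℝ) 1
  univ : μ Set.univ = 1
  union : ∀ S ∈ 𝔄, ∀ T ∈ 𝔄, Disjoint S T → μ (S ∪ T) = μ S + μ T

/-- `N : 𝒜 → [0,1]` is a finitely minitive necessity measure on the algebra `𝒜` (again, values
outside `𝒜` are irrelevant). -/
structure IsNecessity {Ω : Type*} (𝒜 : Set (Set Ω)) (N : Set Ω → ℝ) : Prop where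
  mem_Icc : ∀ A ∈ 𝒜, N A ∈ Set.Icc (0 : ℝ) 1
  empty : N ∅ = 0
  univ : N Set.univ = 1
  inter : ∀ A ∈ 𝒜, ∀ B ∈ 𝒜, N (A ∩ B) = min (N A) (N B)

/-- Lower Darboux–Stieltjes sum of `f` over a finite partition of `X` into non-empty sets. -/
def lowerSum {X : Type*} (μ : Set X → ℝ) (f : X → ℝ)
    (P : Finpartition (Set.univ : Set X)) : ℝ :=
  ∑ S ∈ P.parts, sInf (f '' S) * μ S

/-- Upper Darboux–Stieltjes sum of `f` over a finite partition of `X` into non-empty sets. -/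
def upperSum {X : Type*} (μ : Set X → ℝ) (f : X → ℝ)
    (P : Finpartition (Set.univ : Set X)) : ℝ :=
  ∑ S ∈ P.parts, sSup (f '' S) * μ S

/-- The bounded function `f` is Stieltjes integrable with respect to the finitely additive `μ` on
the algebra `𝔄`, with integral `I`: over the finite partitions of `X` whose members belong to
`𝔄`, the supremum of the lower sums and the infimum of the upper sums are both equal to `I`. -/
structure HasStieltjesIntegral {X : Type*} (𝔄 : Set (Set X)) (μ : Set X → ℝ) (f : X → ℝ)
    (I : ℝ) : Prop where
  bddBelow : BddBelow (Set.range f)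
  bddAbove : BddAbove (Set.range f)
  isLUB : IsLUB (lowerSum μ f '' {P | ∀ S ∈ P.parts, S ∈ 𝔄}) I
  isGLB : IsGLB (upperSum μ f '' {P | ∀ S ∈ P.parts, S ∈ 𝔄}) I

/-- The atoms of an algebra: its minimal non-empty members. For a finite algebra they form the
finest partition of `Ω` contained in it. -/
def atoms {Ω : Type*} (𝒜 : Set (Set Ω)) : Set (Set Ω) :=
  {C | Minimal (fun A => A ∈ 𝒜 ∧ A.Nonempty) C}

/-- The collection of chains `{C₁, C₁ ∪ C₂, …, C₁ ∪ ⋯ ∪ Cₘ}`, where `C₁, …, Cₘ` runs through the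
enumerations without repetition of the (finitely many) atoms of `𝒜`. -/
def chains {Ω : Type*} (𝒜 : Set (Set Ω)) : Set (Finset (Set Ω)) :=
  {𝒟 | ∃ (m : ℕ) (C : Fin m ≃ atoms 𝒜),
    (𝒟 : Set (Set Ω)) = Set.range fun k : Fin m => ⋃ j ≤ k, (C j : Set Ω)}

section Coherence

variable {Ω : Type*} {𝓔 : Set (Set Ω)}

/-- `algebra(ℱ)` for a finite family `ℱ` of events of `𝓔`. -/
def finAlgebra (ℱ : Finset 𝓔) : Set (Set Ω) :=
  algebra ((fun E : 𝓔 => (E : Set Ω)) '' (ℱ : Set 𝓔))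

/-- Extendibility to a finitely minitive necessity measure on `algebra(𝓔)`. -/
def Coherent1N (N : 𝓔 → Set.Icc (0 : ℝ) 1) : Prop :=
  ∃ N' : Set Ω → ℝ, IsNecessity (algebra 𝓔) N' ∧ ∀ E : 𝓔, (N E : ℝ) = N' E

/-- Integral representation by a finitely additive probability. -/
def Coherent2N (N : 𝓔 → Set.Icc (0 : ℝ) 1) : Prop :=
  ∃ μ : Set (nonimpossible (algebra 𝓔)) → ℝ,
    IsFinAddProb (tildeAlgebra (algebra 𝓔)) μ ∧
    IsNecessity (algebra 𝓔) (fun A => μ (tilde (algebra 𝓔) A)) ∧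
    ∀ E : 𝓔, HasStieltjesIntegral (tildeAlgebra (algebra 𝓔)) μ
      (fun B => minInd (B : Set Ω) E) (N E)

/-- Compatibility, for every finite non-empty `ℱ ⊆ 𝓔`, of the linear system associated with some
chain. -/
def Coherent3N (N : 𝓔 → Set.Icc (0 : ℝ) 1) : Prop :=
  ∀ ℱ : Finset 𝓔, ℱ.Nonempty → ∃ 𝒟 ∈ chains (finAlgebra ℱ), ∃ x : 𝒟 → ℝ,
    (∀ E ∈ ℱ, ∑ D : 𝒟, minInd (D : Set Ω) E * x D = N E) ∧
    ∑ D : 𝒟, x D = 1 ∧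
    ∀ D : 𝒟, 0 ≤ x D

/-- Total gain when the information `B` is acquired. -/
def gain (N : 𝓔 → Set.Icc (0 : ℝ) 1) (ℱ : Finset 𝓔) (lam : ℱ → ℝ) (B : Set Ω) : ℝ :=
  ∑ E : ℱ, lam E * (minInd B (E : 𝓔) - N E)

/-- The betting criterion on chains: the maximum of the gain over the chain is non-negative. -/
def Coherent4N (N : 𝓔 → Set.Icc (0 : ℝ) 1) : Prop :=
  ∀ ℱ : Finset 𝓔, ℱ.Nonempty → ∃ 𝒟 ∈ chains (finAlgebra ℱ), ∀ lam : ℱ → ℝ,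
    ∃ M : ℝ, IsGreatest (gain N ℱ lam '' (𝒟 : Set (Set Ω))) M ∧ 0 ≤ M

/-- Total Brier penalty of an assessment `p` of the events of `ℱ` when the information `B` is
acquired. -/
def penalty (ℱ : Finset 𝓔) (p : ℱ → Set.Icc (0 : ℝ) 1) (B : Set Ω) : ℝ :=
  ∑ E : ℱ, (minInd B (E : 𝓔) - p E) ^ 2

/-- The penalty criterion on chains. -/
def Coherent5N (N : 𝓔 → Set.Icc (0 : ℝ) 1) : Prop :=
  ∀ ℱ : Finset 𝓔, ℱ.Nonempty → ∃ 𝒟 ∈ chains (finAlgebra ℱ),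
    ¬ ∃ Nstar : ℱ → Set.Icc (0 : ℝ) 1, Nstar ≠ (fun E : ℱ => N E) ∧
      ∀ D ∈ 𝒟, penalty ℱ Nstar D < penalty ℱ (fun E : ℱ => N E) D

end Coherence

end NecessityCoherence

end

/-!
`Coherent1N` and `Coherent2N` are linked by mixing over levels. If `N'` is a necessity measure and
`t ∈ (0, 1]`, then the events with `N' A ≥ t` form a proper filter, and there is an ultrafilter
`U t` on the non-impossible events which contains `Ã` exactly when `N' A ≥ t`
(`IsNecessity.exists_ultrafilter_tilde`). The Lebesgue measure of the set of levels `t` with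
`S ∈ U t` is a finitely additive probability of `S`, and its value at `Ã` is `N' A`. In the other
direction, the Stieltjes integral in `Coherent2N` is that of the indicator of `Ã`, so it equals `μ Ã`
(`IsFinAddProb.hasStieltjesIntegral_indicator`).

To pass from `Coherent1N` to `Coherent3N`, list the atoms of the finite algebra in decreasing order of possibility
`1 - N' Cᶜ`. The increments of `N'` along the unions of initial segments of the list are then the
masses of a probability on this chain, and they recover `N'` (`IsNecessity.exists_chain_mass`).
Conversely, a mass function on a chain of non-empty sets defines a necessity measure on all
subsets of `Ω` (`isNecessity_of_chain_mass`), so every finite part of the assessment extends to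
one, and compactness of the space of maps from `Set Ω` to `[0, 1]` extends the whole.

`Coherent3N`, `Coherent4N` and `Coherent5N` are equivalent for each chain separately. All of them say that the
assessment is a convex combination of the vectors `(minInd D E)_E`, for `D` in the chain. If it is
not, then its nearest point in their convex hull provides both a separating linear form, which is a
sure loss (`mem_hull_iff_forall_exists_nonneg`), and an assessment with a strictly smaller penalty
at each vertex (`mem_hull_iff_not_exists_closer`).
-/

noncomputable section

namespace NecessityCoherence

open MeasureTheory Set Filter Topology

/-! ### Stieltjes integrals of indicators -/

section FinAdd

variable {X : Type*} {𝔄 : Set (Set X)} {μ : Set X → ℝ}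

theorem IsFinAddProb.apply_empty (hμ : IsFinAddProb 𝔄 μ) (h𝔄 : IsSetAlgebra 𝔄) : μ ∅ = 0 := by
  have := hμ.union ∅ h𝔄.empty_mem ∅ h𝔄.empty_mem (by simp)
  simp at this
  exact this

theorem IsFinAddProb.mono (hμ : IsFinAddProb 𝔄 μ) (h𝔄 : IsSetAlgebra 𝔄) {S T : Set X}
    (hS : S ∈ 𝔄) (hT : T ∈ 𝔄) (h : S ⊆ T) : μ S ≤ μ T := by
  have h1 := hμ.union S hS (T \ S) (h𝔄.sdiff_mem hT hS) disjoint_sdiff_self_right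
  rw [union_sdiff_cancel h] at h1
  have h2 := (hμ.mem_Icc (T \ S) (h𝔄.sdiff_mem hT hS)).1
  linarith

theorem IsFinAddProb.apply_biUnion (hμ : IsFinAddProb 𝔄 μ) (h𝔄 : IsSetAlgebra 𝔄)
    {ι : Type*} (s : Finset ι) (f : ι → Set X) (hf : ∀ i ∈ s, f i ∈ 𝔄)
    (hd : (s : Set ι).PairwiseDisjoint f) : μ (⋃ i ∈ s, f i) = ∑ i ∈ s, μ (f i) := by
  classical
  induction s using Finset.induction_on with
  | empty => simpa using hμ.apply_empty h𝔄
  | insert a s ha ih =>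
    rw [Finset.sum_insert ha, Finset.set_biUnion_insert, hμ.union, ih]
    · exact fun i hi => hf i (Finset.mem_insert_of_mem hi)
    · exact hd.subset (by simp)
    · exact hf a (Finset.mem_insert_self _ _)
    · exact h𝔄.biUnion_mem s fun i hi => hf i (Finset.mem_insert_of_mem hi)
    · refine disjoint_iUnion₂_right.2 fun i hi => hd (by simp) (by simp [hi]) ?_
      rintro rfl
      exact ha hi

theorem IsFinAddProb.apply_eq_sum_parts (hμ : IsFinAddProb 𝔄 μ) (h𝔄 : IsSetAlgebra 𝔄)
    (P : Finpartition (Set.univ : Set X)) (hP : ∀ S ∈ P.parts, S ∈ 𝔄) {T : Set X} (hT : T ∈ 𝔄) :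
    μ T = ∑ S ∈ P.parts, μ (T ∩ S) := by
  rw [← hμ.apply_biUnion h𝔄 P.parts (fun S => T ∩ S) (fun S hS => h𝔄.inter_mem hT (hP S hS))]
  · congr 1
    have := P.sup_parts
    rw [Finset.sup_id_set_eq_sUnion] at this
    ext x
    have hx : x ∈ ⋃₀ (P.parts : Set (Set X)) := by rw [this]; trivial
    obtain ⟨S, hS, hxS⟩ := hx
    simp only [mem_iUnion, mem_inter_iff, exists_prop]
    exact ⟨fun h => ⟨S, hS, h, hxS⟩, fun ⟨_, _, h, _⟩ => h⟩
  · intro S hS S' hS' hne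
    exact (P.disjoint hS hS' hne).mono inter_subset_right inter_subset_right

theorem image_indicator_one_of_subset {S T : Set X} (hS : S.Nonempty) (h : S ⊆ T) :
    T.indicator (1 : X → ℝ) '' S = {1} := by
  rw [image_congr (g := fun _ => (1 : ℝ)) fun x hx => by simp [h hx], hS.image_const]

theorem image_indicator_one_of_disjoint {S T : Set X} (hS : S.Nonempty) (h : Disjoint S T) :
    T.indicator (1 : X → ℝ) '' S = {0} := by
  rw [image_congr (g := fun _ => (0 : ℝ)) fun x hx => by simp [disjoint_left.1 h hx],
    hS.image_const]

theorem indicator_one_mem_Icc (T : Set X) (x : X) :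
    T.indicator (1 : X → ℝ) x ∈ Icc (0 : ℝ) 1 := by
  by_cases hx : x ∈ T <;> simp [hx]

theorem lowerSum_indicator_le (hμ : IsFinAddProb 𝔄 μ) (h𝔄 : IsSetAlgebra 𝔄) {T : Set X}
    (hT : T ∈ 𝔄) (P : Finpartition (Set.univ : Set X)) (hP : ∀ S ∈ P.parts, S ∈ 𝔄) :
    lowerSum μ (T.indicator 1) P ≤ μ T := by
  rw [hμ.apply_eq_sum_parts h𝔄 P hP hT]
  refine Finset.sum_le_sum fun S hS => ?_
  have hne : S.Nonempty := nonempty_iff_ne_empty.2 (P.ne_bot hS)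
  have hnn := (hμ.mem_Icc _ (h𝔄.inter_mem hT (hP S hS))).1
  by_cases h : S ⊆ T
  · rw [image_indicator_one_of_subset hne h, inter_eq_self_of_subset_right h]
    simp
  · obtain ⟨x, hx, hxT⟩ := not_subset.1 h
    have h0 : IsLeast (T.indicator (1 : X → ℝ) '' S) 0 :=
      ⟨⟨x, hx, by simp [hxT]⟩, by rintro _ ⟨y, -, rfl⟩; exact (indicator_one_mem_Icc T y).1⟩
    rwa [h0.csInf_eq, zero_mul]

theorem le_upperSum_indicator (hμ : IsFinAddProb 𝔄 μ) (h𝔄 : IsSetAlgebra 𝔄) {T : Set X}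
    (hT : T ∈ 𝔄) (P : Finpartition (Set.univ : Set X)) (hP : ∀ S ∈ P.parts, S ∈ 𝔄) :
    μ T ≤ upperSum μ (T.indicator 1) P := by
  rw [hμ.apply_eq_sum_parts h𝔄 P hP hT]
  refine Finset.sum_le_sum fun S hS => ?_
  have hne : S.Nonempty := nonempty_iff_ne_empty.2 (P.ne_bot hS)
  by_cases h : Disjoint S T
  · rw [image_indicator_one_of_disjoint hne h, h.symm.inter_eq, hμ.apply_empty h𝔄]
    simp
  · obtain ⟨x, hx, hxT⟩ := not_disjoint_iff.1 h
    have h1 : IsGreatest (T.indicator (1 : X → ℝ) '' S) 1 :=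
      ⟨⟨x, hx, by simp [hxT]⟩, by rintro _ ⟨y, -, rfl⟩; exact (indicator_one_mem_Icc T y).2⟩
    rw [h1.csSup_eq, one_mul]
    exact hμ.mono h𝔄 (h𝔄.inter_mem hT (hP S hS)) (hP S hS) inter_subset_right

open Classical in
/-- The partition `{T, Tᶜ}`, from which an empty part is dropped. -/
def complPartition (T : Set X) : Finpartition (Set.univ : Set X) :=
  Finpartition.ofErase {T, Tᶜ}
    (by
      rw [Finset.supIndep_iff_pairwiseDisjoint]
      intro A hA B hB hne
      simp only [Finset.coe_insert, Finset.coe_singleton, mem_insert_iff,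
        mem_singleton_iff] at hA hB
      rcases hA with rfl | rfl <;> rcases hB with rfl | rfl
      · exact absurd rfl hne
      · exact disjoint_compl_right
      · exact disjoint_compl_left
      · exact absurd rfl hne)
    (by simp)

theorem sum_complPartition [Nonempty X] (T : Set X) (g : Set X → ℝ) (hg : g ∅ = 0) :
    ∑ S ∈ (complPartition T).parts, g S = g T + g Tᶜ := by
  classical
  rw [← Finset.sum_pair (f := g) (a := T) (b := Tᶜ) (ne_compl_self (a := T))]
  simp only [complPartition, Finpartition.ofErase]
  exact Finset.sum_erase _ hg

theorem mem_of_mem_complPartition (h𝔄 : IsSetAlgebra 𝔄) {T : Set X} (hT : T ∈ 𝔄) :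
    ∀ S ∈ (complPartition T).parts, S ∈ 𝔄 := by
  classical
  intro S hS
  have : S = T ∨ S = Tᶜ := by
    simp [complPartition, Finpartition.ofErase] at hS
    exact hS.2
  rcases this with rfl | rfl
  · exact hT
  · exact h𝔄.compl_mem hT

/-- The Stieltjes integral of the indicator of a member of the algebra is its probability. -/
theorem IsFinAddProb.hasStieltjesIntegral_indicator [Nonempty X] (hμ : IsFinAddProb 𝔄 μ)
    (h𝔄 : IsSetAlgebra 𝔄) {T : Set X} (hT : T ∈ 𝔄) :
    HasStieltjesIntegral 𝔄 μ (T.indicator 1) (μ T) := by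
  have h1 : sInf (T.indicator (1 : X → ℝ) '' T) * μ T = μ T := by
    rcases T.eq_empty_or_nonempty with rfl | h
    · simp [hμ.apply_empty h𝔄]
    · simp [image_indicator_one_of_subset h subset_rfl]
  have h2 : sSup (T.indicator (1 : X → ℝ) '' T) * μ T = μ T := by
    rcases T.eq_empty_or_nonempty with rfl | h
    · simp [hμ.apply_empty h𝔄]
    · simp [image_indicator_one_of_subset h subset_rfl]
  have h3 : sInf (T.indicator (1 : X → ℝ) '' Tᶜ) * μ Tᶜ = 0 := by
    rcases Tᶜ.eq_empty_or_nonempty with h | h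
    · simp [h]
    · simp [image_indicator_one_of_disjoint h disjoint_compl_left]
  have h4 : sSup (T.indicator (1 : X → ℝ) '' Tᶜ) * μ Tᶜ = 0 := by
    rcases Tᶜ.eq_empty_or_nonempty with h | h
    · simp [h]
    · simp [image_indicator_one_of_disjoint h disjoint_compl_left]
  refine ⟨⟨0, ?_⟩, ⟨1, ?_⟩, IsGreatest.isLUB ⟨?_, ?_⟩, IsLeast.isGLB ⟨?_, ?_⟩⟩
  · rintro _ ⟨x, rfl⟩
    exact (indicator_one_mem_Icc T x).1
  · rintro _ ⟨x, rfl⟩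
    exact (indicator_one_mem_Icc T x).2
  · refine ⟨complPartition T, mem_of_mem_complPartition h𝔄 hT, ?_⟩
    rw [lowerSum, sum_complPartition T _ (by simp), h1, h3, add_zero]
  · rintro _ ⟨P, hP, rfl⟩
    exact lowerSum_indicator_le hμ h𝔄 hT P hP
  · refine ⟨complPartition T, mem_of_mem_complPartition h𝔄 hT, ?_⟩
    rw [upperSum, sum_complPartition T _ (by simp), h2, h4, add_zero]
  · rintro _ ⟨P, hP, rfl⟩
    exact le_upperSum_indicator hμ h𝔄 hT P hP

end FinAdd

/-! ### Integral representation of necessity measures -/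

section Representation

variable {Ω : Type*} {𝒜 : Set (Set Ω)} {N : Set Ω → ℝ}

theorem IsNecessity.mono (hN : IsNecessity 𝒜 N) {A B : Set Ω} (hA : A ∈ 𝒜) (hB : B ∈ 𝒜)
    (h : A ⊆ B) : N A ≤ N B := by
  have := hN.inter A hA B hB
  rw [inter_eq_self_of_subset_left h] at this
  rw [this]
  exact min_le_right _ _

theorem IsNecessity.nonempty_of_pos (hN : IsNecessity 𝒜 N) {A : Set Ω} (h : 0 < N A) :
    A.Nonempty := by
  rw [nonempty_iff_ne_empty]
  rintro rfl
  exact h.ne' hN.empty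

theorem univ_mem_nonimpossible [Nonempty Ω] (h𝒜 : IsSetAlgebra 𝒜) :
    Set.univ ∈ nonimpossible 𝒜 :=
  ⟨h𝒜.univ_mem, univ_nonempty.ne_empty⟩

theorem tilde_empty : tilde 𝒜 ∅ = ∅ := by
  ext B
  simpa [tilde] using B.2.2

theorem tilde_mem_tildeAlgebra {A : Set Ω} (hA : A ∈ 𝒜) : tilde 𝒜 A ∈ tildeAlgebra 𝒜 := by
  by_cases h : A = ∅
  · rw [h, tilde_empty]
    exact isSetAlgebra_generateSetAlgebra.empty_mem
  · exact self_subset_generateSetAlgebra ⟨A, ⟨hA, h⟩, rfl⟩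

theorem minInd_eq_indicator_tilde (E : Set Ω) :
    (fun B : nonimpossible 𝒜 => minInd (B : Set Ω) E) = (tilde 𝒜 E).indicator 1 := by
  classical
  ext B
  by_cases h : (B : Set Ω) ⊆ E <;> simp [minInd, tilde, h]

/-- The cut of a necessity measure at a level `t ∈ (0, 1]` is a filter of events. The sets
`{B | B ⊆ A, t ≤ N B}`, for `A` in the cut, are a filter base on the non-impossible events, and
any finer ultrafilter picks out exactly the sets `Ã` with `A` in the cut. -/
theorem IsNecessity.exists_ultrafilter_tilde (h𝒜 : IsSetAlgebra 𝒜) (hN : IsNecessity 𝒜 N)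
    {t : ℝ} (ht : t ∈ Ioc (0 : ℝ) 1) :
    ∃ U : Ultrafilter (nonimpossible 𝒜), ∀ A ∈ 𝒜, tilde 𝒜 A ∈ U ↔ t ≤ N A := by
  let G : {A // A ∈ 𝒜 ∧ t ≤ N A} → Set (nonimpossible 𝒜) :=
    fun A => {B | (B : Set Ω) ⊆ A ∧ t ≤ N B}
  have huniv : Set.univ ∈ 𝒜 ∧ t ≤ N Set.univ := ⟨h𝒜.univ_mem, by rw [hN.univ]; exact ht.2⟩
  have : Nonempty {A // A ∈ 𝒜 ∧ t ≤ N A} := ⟨⟨Set.univ, huniv⟩⟩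
  have hdir : Directed (· ≥ ·) fun A => 𝓟 (G A) := by
    intro A B
    refine ⟨⟨A ∩ B, h𝒜.inter_mem A.2.1 B.2.1, ?_⟩, ?_, ?_⟩
    · rw [hN.inter _ A.2.1 _ B.2.1]
      exact le_min A.2.2 B.2.2
    · exact principal_mono.2 fun C hC => ⟨hC.1.trans inter_subset_left, hC.2⟩
    · exact principal_mono.2 fun C hC => ⟨hC.1.trans inter_subset_right, hC.2⟩
  have hne : (⨅ A, 𝓟 (G A)).NeBot := by
    refine iInf_neBot_of_directed' hdir fun A => principal_neBot_iff.2 ?_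
    exact ⟨⟨A, A.2.1, (hN.nonempty_of_pos (ht.1.trans_le A.2.2)).ne_empty⟩, subset_rfl, A.2.2⟩
  have hmem : ∀ A, G A ∈ Ultrafilter.of (⨅ A, 𝓟 (G A)) := fun A =>
    Ultrafilter.of_le _ (mem_iInf_of_mem A (mem_principal_self _))
  refine ⟨Ultrafilter.of (⨅ A, 𝓟 (G A)), fun A hA => ⟨fun h => ?_, fun h => ?_⟩⟩
  · obtain ⟨B, hBA, -, hB⟩ := Ultrafilter.nonempty_of_mem (inter_mem h (hmem ⟨Set.univ, huniv⟩))
    exact hB.trans (hN.mono B.2.1 hA hBA)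
  · exact mem_of_superset (hmem ⟨A, hA, h⟩) fun B hB => hB.1

/-- A necessity measure is a mixture, over its levels `t`, of the zero-one finitely additive
probabilities given by the ultrafilters of `IsNecessity.exists_ultrafilter_tilde`. Since these are
ultrafilters, the sets `S` for which `{t | S ∈ U t}` is measurable form an algebra. -/
theorem IsNecessity.exists_finAddProb [Nonempty Ω] (h𝒜 : IsSetAlgebra 𝒜) (hN : IsNecessity 𝒜 N) :
    ∃ μ : Set (nonimpossible 𝒜) → ℝ,
      IsFinAddProb (tildeAlgebra 𝒜) μ ∧ ∀ A ∈ 𝒜, μ (tilde 𝒜 A) = N A := by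
  have : Inhabited (nonimpossible 𝒜) := ⟨⟨Set.univ, univ_mem_nonimpossible h𝒜⟩⟩
  have hU : ∀ t : ℝ, ∃ U : Ultrafilter (nonimpossible 𝒜), t ∈ Ioc (0 : ℝ) 1 →
      ∀ A ∈ 𝒜, tilde 𝒜 A ∈ U ↔ t ≤ N A := by
    intro t
    by_cases ht : t ∈ Ioc (0 : ℝ) 1
    · obtain ⟨U, hU⟩ := hN.exists_ultrafilter_tilde h𝒜 ht
      exact ⟨U, fun _ => hU⟩
    · exact ⟨default, fun h => absurd h ht⟩
  choose U hU using hU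
  let L : Set (nonimpossible 𝒜) → Set ℝ := fun S => Ioc 0 1 ∩ {t | S ∈ U t}
  have hL : ∀ A ∈ 𝒜, L (tilde 𝒜 A) = Ioc 0 (N A) := by
    intro A hA
    ext t
    constructor
    · exact fun ⟨ht, h⟩ => ⟨ht.1, (hU t ht A hA).1 h⟩
    · intro h
      have ht : t ∈ Ioc (0 : ℝ) 1 := ⟨h.1, h.2.trans (hN.mem_Icc A hA).2⟩
      exact ⟨ht, (hU t ht A hA).2 h.2⟩
  have hLuniv : L Set.univ = Ioc 0 1 := by
    ext t
    exact ⟨fun h => h.1, fun h => ⟨h, univ_mem⟩⟩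
  have hmeas : ∀ S ∈ tildeAlgebra 𝒜, MeasurableSet (L S) := by
    intro S hS
    induction hS with
    | base S hS =>
      obtain ⟨A, hA, rfl⟩ := hS
      rw [hL A hA.1]
      exact measurableSet_Ioc
    | empty =>
      have : L ∅ = ∅ := by
        ext t
        exact ⟨fun h => absurd h.2 (Ultrafilter.empty_notMem), fun h => h.elim⟩
      rw [this]
      exact MeasurableSet.empty
    | compl S _ ih =>
      have : L Sᶜ = Ioc 0 1 \ L S := by
        ext t
        simp only [L, mem_inter_iff, mem_ofPred_eq, Ultrafilter.compl_mem_iff_notMem, Set.mem_sdiff]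
        tauto
      rw [this]
      exact measurableSet_Ioc.diff ih
    | union S T _ _ ihS ihT =>
      have : L (S ∪ T) = L S ∪ L T := by
        ext t
        simp only [L, mem_inter_iff, mem_ofPred_eq, Ultrafilter.union_mem_iff, mem_union]
        tauto
      rw [this]
      exact ihS.union ihT
  have hfin : ∀ S, volume (L S) ≠ ⊤ := fun S =>
    measure_ne_top_of_subset inter_subset_left (by simp)
  refine ⟨fun S => volume.real (L S), ⟨fun S _ => ⟨measureReal_nonneg, ?_⟩, ?_, ?_⟩, ?_⟩
  · refine (measureReal_mono inter_subset_left (by simp)).trans (le_of_eq (b := (1 : ℝ)) ?_)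
    simp
  · simp [hLuniv]
  · intro S hS T hT hd
    have hunion : L (S ∪ T) = L S ∪ L T := by
      ext t
      simp only [L, mem_inter_iff, mem_ofPred_eq, Ultrafilter.union_mem_iff, mem_union]
      tauto
    have hdisj : Disjoint (L S) (L T) := by
      rw [disjoint_left]
      intro t hs ht
      have := inter_mem hs.2 ht.2
      rw [hd.inter_eq] at this
      exact Ultrafilter.empty_notMem this
    simp only [hunion]
    exact measureReal_union hdisj (hmeas T hT) (hfin S) (hfin T)
  · intro A hA
    simp [hL A hA, (hN.mem_Icc A hA).1]

variable {𝓔 : Set (Set Ω)}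

theorem coherent1N_iff_coherent2N [Nonempty Ω] (P : 𝓔 → Icc (0 : ℝ) 1) :
    Coherent1N P ↔ Coherent2N P := by
  have h𝒜 : IsSetAlgebra (algebra 𝓔) := isSetAlgebra_generateSetAlgebra
  have : Nonempty (nonimpossible (algebra 𝓔)) := ⟨⟨Set.univ, univ_mem_nonimpossible h𝒜⟩⟩
  have key : ∀ {μ}, IsFinAddProb (tildeAlgebra (algebra 𝓔)) μ → ∀ E : 𝓔,
      HasStieltjesIntegral (tildeAlgebra (algebra 𝓔)) μ (fun B => minInd (B : Set Ω) E)
        (μ (tilde (algebra 𝓔) E)) := by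
    intro μ hμ E
    rw [minInd_eq_indicator_tilde]
    exact hμ.hasStieltjesIntegral_indicator isSetAlgebra_generateSetAlgebra
      (tilde_mem_tildeAlgebra (self_subset_generateSetAlgebra E.2))
  constructor
  · rintro ⟨N', hN', hE⟩
    obtain ⟨μ, hμ, h⟩ := hN'.exists_finAddProb h𝒜
    refine ⟨μ, hμ, ⟨fun A hA => ?_, ?_, ?_, fun A hA B hB => ?_⟩, fun E => ?_⟩
    · rw [h A hA]
      exact hN'.mem_Icc A hA
    · rw [h _ h𝒜.empty_mem, hN'.empty]
    · rw [h _ h𝒜.univ_mem, hN'.univ]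
    · rw [h A hA, h B hB, h _ (h𝒜.inter_mem hA hB), hN'.inter A hA B hB]
    · rw [hE E, ← h E (self_subset_generateSetAlgebra E.2)]
      exact key hμ E
  · rintro ⟨μ, hμ, hnec, hint⟩
    exact ⟨_, hnec, fun E => (hint E).isLUB.unique (key hμ E).isLUB⟩

end Representation

/-! ### Convex hulls of finite sets of vertices -/

section Projection

variable {ι κ : Type*} [Fintype ι] [Fintype κ]

/-- Weighted average of the sums of squares about `q`, compared with those about the weighted
mean `p` of the vertices. -/
theorem sum_mul_sum_sq_sub (v : κ → ι → ℝ) (x : κ → ℝ) (p q : ι → ℝ) (hx : ∑ k, x k = 1)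
    (hp : ∀ i, ∑ k, v k i * x k = p i) :
    ∑ k, x k * ∑ i, (v k i - q i) ^ 2 =
      (∑ k, x k * ∑ i, (v k i - p i) ^ 2) + ∑ i, (q i - p i) ^ 2 := by
  simp only [Finset.mul_sum]
  rw [Finset.sum_comm, Finset.sum_comm (s := (Finset.univ : Finset κ)), ← Finset.sum_add_distrib]
  refine Finset.sum_congr rfl fun i _ => ?_
  have h1 : ∑ k, x k * (v k i - q i) ^ 2 = ∑ k, x k * (v k i - p i) ^ 2
      + 2 * (p i - q i) * ∑ k, v k i * x k
      + (q i ^ 2 - p i ^ 2) * ∑ k, x k := by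
    rw [Finset.mul_sum, Finset.mul_sum, ← Finset.sum_add_distrib, ← Finset.sum_add_distrib]
    exact Finset.sum_congr rfl fun k _ => by ring
  rw [h1, hx, hp]
  ring

/-- A point `p` that is not a convex combination of the finitely many points `v k` has a nearest
point `q ≠ p` among these combinations, and the angle at `q` is obtuse. -/
theorem exists_nearest_of_not_mem_hull [Nonempty κ] (v : κ → ι → ℝ) (p : ι → ℝ)
    (h : ¬ ∃ x : κ → ℝ, (∀ i, ∑ k, v k i * x k = p i) ∧ ∑ k, x k = 1 ∧ ∀ k, 0 ≤ x k) :
    ∃ q : ι → ℝ, (∃ x : κ → ℝ, (∀ i, ∑ k, v k i * x k = q i) ∧ ∑ k, x k = 1 ∧ ∀ k, 0 ≤ x k) ∧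
      q ≠ p ∧ ∀ k, ∑ i, (p i - q i) * (v k i - q i) ≤ 0 := by
  classical
  let f : (κ → ℝ) →ₗ[ℝ] EuclideanSpace ℝ ι :=
    Fintype.linearCombination ℝ fun k => WithLp.toLp 2 (v k)
  have hf : ∀ x i, f x i = ∑ k, v k i * x k := by
    intro x i
    simp [f, Fintype.linearCombination_apply, mul_comm]
  let K : Set (EuclideanSpace ℝ ι) := f '' stdSimplex ℝ κ
  have hconv : Convex ℝ K := (convex_stdSimplex ℝ κ).linear_image f
  have hcomp : IsComplete K :=
    ((isCompact_stdSimplex ℝ κ).image f.continuous_of_finiteDimensional).isComplete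
  have hvert : ∀ k, WithLp.toLp 2 (v k) ∈ K := fun k =>
    ⟨Pi.single k 1, single_mem_stdSimplex ℝ k, by simp [f]⟩
  have hne : K.Nonempty := ⟨_, hvert (Classical.arbitrary κ)⟩
  obtain ⟨q, hq, hmin⟩ := exists_norm_eq_iInf_of_complete_convex hne hcomp hconv (WithLp.toLp 2 p)
  rw [norm_eq_iInf_iff_real_inner_le_zero hconv hq] at hmin
  obtain ⟨x, hx, rfl⟩ := hq
  refine ⟨f x, ⟨x, fun i => (hf x i).symm, hx.2, hx.1⟩, ?_, fun k => ?_⟩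
  · intro hqp
    exact h ⟨x, fun i => by rw [← hf, hqp], hx.2, hx.1⟩
  · have := hmin _ (hvert k)
    simp only [PiLp.inner_apply, RCLike.inner_apply, conj_trivial, PiLp.sub_apply] at this
    simpa only [mul_comm] using this

/-- Gordan's alternative: a point is a convex combination of finitely many vertices iff no linear
form is negative at all the vertices relative to the point. -/
theorem mem_hull_iff_forall_exists_nonneg [Nonempty κ] (v : κ → ι → ℝ) (p : ι → ℝ) :
    (∃ x : κ → ℝ, (∀ i, ∑ k, v k i * x k = p i) ∧ ∑ k, x k = 1 ∧ ∀ k, 0 ≤ x k) ↔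
      ∀ lam : ι → ℝ, ∃ k, 0 ≤ ∑ i, lam i * (v k i - p i) := by
  constructor
  · rintro ⟨x, hp, hx, hnn⟩ lam
    by_contra! hneg
    have h0 : ∑ k, x k * ∑ i, lam i * (v k i - p i) = 0 := by
      simp only [Finset.mul_sum]
      rw [Finset.sum_comm]
      refine Finset.sum_eq_zero fun i _ => ?_
      have : ∑ k, x k * (lam i * (v k i - p i))
          = lam i * (∑ k, v k i * x k - p i * ∑ k, x k) := by
        rw [Finset.mul_sum (a := p i), ← Finset.sum_sub_distrib, Finset.mul_sum]
        exact Finset.sum_congr rfl fun k _ => by ring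
      rw [this, hp, hx]
      ring
    obtain ⟨k, -, hk⟩ : ∃ k ∈ Finset.univ, (0 : κ → ℝ) k < x k :=
      Finset.exists_lt_of_sum_lt (by simp [hx])
    have : ∑ k, x k * ∑ i, lam i * (v k i - p i) < 0 :=
      Finset.sum_neg' (fun k _ => mul_nonpos_of_nonneg_of_nonpos (hnn k) (hneg k).le)
        ⟨k, Finset.mem_univ k, mul_neg_of_pos_of_neg hk (hneg k)⟩
    exact this.ne h0
  · intro hlam
    by_contra hp
    obtain ⟨q, -, hqp, hq⟩ := exists_nearest_of_not_mem_hull v p hp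
    obtain ⟨k, hk⟩ := hlam fun i => p i - q i
    have hpos : 0 < ∑ i, (p i - q i) ^ 2 := by
      obtain ⟨i, hi⟩ := Function.ne_iff.1 hqp
      exact Finset.sum_pos' (fun i _ => sq_nonneg _)
        ⟨i, Finset.mem_univ i, sq_pos_of_ne_zero (sub_ne_zero.2 hi.symm)⟩
    have : ∑ i, (p i - q i) * (v k i - p i)
        = ∑ i, (p i - q i) * (v k i - q i) - ∑ i, (p i - q i) ^ 2 := by
      rw [← Finset.sum_sub_distrib]
      exact Finset.sum_congr rfl fun i _ => by ring
    linarith [hq k]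

/-- A point of the unit cube is a convex combination of finitely many points of the cube iff no
other point of the cube is strictly closer to all of them. The nearest point of the hull is a
strictly closer one; conversely, the mean minimizes the average squared distance. -/
theorem mem_hull_iff_not_exists_closer [Nonempty κ] (v : κ → ι → ℝ)
    (hv : ∀ k i, v k i ∈ Icc (0 : ℝ) 1) (p : ι → Icc (0 : ℝ) 1) :
    (∃ x : κ → ℝ, (∀ i, ∑ k, v k i * x k = p i) ∧ ∑ k, x k = 1 ∧ ∀ k, 0 ≤ x k) ↔
      ¬ ∃ q : ι → Icc (0 : ℝ) 1, q ≠ p ∧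
        ∀ k, ∑ i, (v k i - q i) ^ 2 < ∑ i, (v k i - p i) ^ 2 := by
  constructor
  · rintro ⟨x, hp, hx, hnn⟩ ⟨q, -, hq⟩
    have h1 := sum_mul_sum_sq_sub v x (fun i => p i) (fun i => q i) hx hp
    obtain ⟨k, -, hk⟩ : ∃ k ∈ Finset.univ, (0 : κ → ℝ) k < x k :=
      Finset.exists_lt_of_sum_lt (by simp [hx])
    have h2 : ∑ k, x k * ∑ i, (v k i - q i) ^ 2 < ∑ k, x k * ∑ i, (v k i - p i) ^ 2 :=
      Finset.sum_lt_sum (fun k _ => mul_le_mul_of_nonneg_left (hq k).le (hnn k))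
        ⟨k, Finset.mem_univ k, mul_lt_mul_of_pos_left (hq k) hk⟩
    have h3 : 0 ≤ ∑ i, ((q i : ℝ) - p i) ^ 2 := Finset.sum_nonneg fun i _ => sq_nonneg _
    linarith
  · intro h
    by_contra hp
    obtain ⟨q, ⟨x, hx, hx1, hnn⟩, hqp, hq⟩ :=
      exists_nearest_of_not_mem_hull v (fun i => (p i : ℝ)) hp
    have hq01 : ∀ i, q i ∈ Icc (0 : ℝ) 1 := by
      intro i
      rw [← hx i]
      refine ⟨Finset.sum_nonneg fun k _ => mul_nonneg (hv k i).1 (hnn k), ?_⟩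
      rw [← hx1]
      exact Finset.sum_le_sum fun k _ => mul_le_of_le_one_left (hnn k) (hv k i).2
    refine h ⟨fun i => ⟨q i, hq01 i⟩, fun heq => hqp ?_, fun k => ?_⟩
    · rw [← heq]
    · have hpos : 0 < ∑ i, ((p i : ℝ) - q i) ^ 2 := by
        obtain ⟨i, hi⟩ := Function.ne_iff.1 hqp
        exact Finset.sum_pos' (fun i _ => sq_nonneg _)
          ⟨i, Finset.mem_univ i, sq_pos_of_ne_zero (sub_ne_zero.2 hi.symm)⟩
      have : ∑ i, (v k i - p i) ^ 2 = ∑ i, (v k i - q i) ^ 2 + ∑ i, ((p i : ℝ) - q i) ^ 2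
          - 2 * ∑ i, ((p i : ℝ) - q i) * (v k i - q i) := by
        rw [Finset.mul_sum, ← Finset.sum_add_distrib, ← Finset.sum_sub_distrib]
        exact Finset.sum_congr rfl fun i _ => by ring
      simp only
      linarith [hq k]

end Projection

/-! ### Atoms of finitely generated algebras -/

section Atoms

variable {Ω : Type*} {𝒜 : Set (Set Ω)} {𝒢 : Set (Set Ω)}

theorem minimal_of_mem_atoms {C : Set Ω} (hC : C ∈ atoms 𝒜) :
    Minimal (fun A => A ∈ 𝒜 ∧ A.Nonempty) C :=
  hC

theorem subset_or_disjoint_of_mem_atoms (h𝒜 : IsSetAlgebra 𝒜) {C A : Set Ω} (hC : C ∈ atoms 𝒜)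
    (hA : A ∈ 𝒜) : C ⊆ A ∨ Disjoint A C := by
  rw [or_iff_not_imp_right, not_disjoint_iff_nonempty_inter, inter_comm]
  intro hne
  exact ((minimal_of_mem_atoms hC).le_of_le ⟨h𝒜.inter_mem (minimal_of_mem_atoms hC).prop.1 hA, hne⟩ inter_subset_left).trans inter_subset_right

theorem disjoint_of_mem_atoms (h𝒜 : IsSetAlgebra 𝒜) {C D : Set Ω} (hC : C ∈ atoms 𝒜)
    (hD : D ∈ atoms 𝒜) (hne : C ≠ D) : Disjoint C D := by
  rcases subset_or_disjoint_of_mem_atoms h𝒜 hD (minimal_of_mem_atoms hC).prop.1 with h | h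
  · exact absurd (h.antisymm ((minimal_of_mem_atoms hC).le_of_le (minimal_of_mem_atoms hD).prop h)).symm hne
  · exact h

/-- The set of points that belong to the same members of `𝒢` as `ω`. -/
def cell (𝒢 : Set (Set Ω)) (ω : Ω) : Set Ω :=
  {ω' | ∀ E ∈ 𝒢, ω ∈ E ↔ ω' ∈ E}

theorem mem_iff_mem_of_mem_cell {A : Set Ω} (hA : A ∈ algebra 𝒢) {ω ω' : Ω}
    (h : ω' ∈ cell 𝒢 ω) : ω ∈ A ↔ ω' ∈ A := by
  induction hA with
  | base s hs => exact h s hs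
  | empty => exact Iff.rfl
  | compl s _ ih => exact not_congr ih
  | union s t _ _ ihs iht => exact or_congr ihs iht

theorem cell_mem_algebra (h𝒢 : 𝒢.Finite) (ω : Ω) : cell 𝒢 ω ∈ algebra 𝒢 := by
  classical
  have heq : cell 𝒢 ω = ⋂ E ∈ h𝒢.toFinset, if ω ∈ E then E else Eᶜ := by
    ext ω'
    simp only [cell, mem_ofPred_eq, mem_iInter, Finite.mem_toFinset]
    refine forall₂_congr fun E _ => ?_
    by_cases h : ω ∈ E <;> simp [h]
  rw [heq]
  refine isSetAlgebra_generateSetAlgebra.biInter_mem _ fun E hE => ?_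
  have hE' : E ∈ algebra 𝒢 := self_subset_generateSetAlgebra (h𝒢.mem_toFinset.1 hE)
  split_ifs
  · exact hE'
  · exact isSetAlgebra_generateSetAlgebra.compl_mem hE'

theorem cell_mem_atoms (h𝒢 : 𝒢.Finite) (ω : Ω) : cell 𝒢 ω ∈ atoms (algebra 𝒢) := by
  refine ⟨⟨cell_mem_algebra h𝒢 ω, ω, fun _ _ => Iff.rfl⟩, ?_⟩
  rintro A ⟨hA, ω', hω'⟩ hle
  have hω : ω ∈ A := (mem_iff_mem_of_mem_cell hA (hle hω')).2 hω'
  exact fun ω'' h => (mem_iff_mem_of_mem_cell hA h).1 hω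

theorem sUnion_atoms (h𝒢 : 𝒢.Finite) : ⋃₀ atoms (algebra 𝒢) = Set.univ :=
  eq_univ_of_forall fun ω => ⟨_, cell_mem_atoms h𝒢 ω, fun _ _ => Iff.rfl⟩

theorem atoms_finite (h𝒢 : 𝒢.Finite) : (atoms (algebra 𝒢)).Finite := by
  -- An atom is determined by the members of `𝒢` that contain it.
  refine Finite.of_injOn (f := fun C => {E ∈ 𝒢 | C ⊆ E}) (t := 𝒢.powerset)
    (fun C _ => sep_subset _ _) ?_ h𝒢.finite_subsets
  have key : ∀ C ∈ atoms (algebra 𝒢), ∀ ω ∈ C, ∀ E ∈ 𝒢, ω ∈ E ↔ C ⊆ E := by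
    intro C hC ω hω E hE
    refine ⟨fun h => ?_, fun h => h hω⟩
    refine (subset_or_disjoint_of_mem_atoms isSetAlgebra_generateSetAlgebra hC
      (self_subset_generateSetAlgebra hE)).resolve_right fun hd => ?_
    exact disjoint_left.1 hd h hω
  intro C hC D hD heq
  obtain ⟨ω, hω⟩ := (minimal_of_mem_atoms hC).prop.2
  obtain ⟨ω', hω'⟩ := (minimal_of_mem_atoms hD).prop.2
  by_contra hne
  have hcell : ω' ∈ cell 𝒢 ω := by
    intro E hE
    rw [key C hC ω hω E hE, key D hD ω' hω' E hE]
    have := Set.ext_iff.1 heq E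
    simpa [hE] using this
  have hmem : ω' ∈ C := (mem_iff_mem_of_mem_cell (minimal_of_mem_atoms hC).prop.1 hcell).1 hω
  exact disjoint_left.1 (disjoint_of_mem_atoms isSetAlgebra_generateSetAlgebra hC hD hne) hmem hω'

end Atoms

/-! ### Necessity measures carried by a chain of focal events -/

section Chains

variable {Ω : Type*} {𝒜 : Set (Set Ω)}

theorem minInd_congr {B E F : Set Ω} (h : B ⊆ E ↔ B ⊆ F) : minInd B E = minInd B F := by
  unfold minInd
  split_ifs <;> tauto

theorem minInd_mem_Icc (B E : Set Ω) : minInd B E ∈ Icc (0 : ℝ) 1 := by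
  unfold minInd
  split_ifs <;> simp

/-- A necessity measure on an algebra with finitely many atoms has a mass function carried by a
chain. The atoms `C` are listed in increasing order of `N Cᶜ`, that is, in decreasing order of
possibility; the mass of the union of the first `n + 1` atoms is the increment of `N` on passing
to it from the union of the first `n`. -/
theorem IsNecessity.exists_chain_mass (h𝒜 : IsSetAlgebra 𝒜) (hfin : (atoms 𝒜).Finite)
    (hcov : ⋃₀ atoms 𝒜 = Set.univ) {N : Set Ω → ℝ} (hN : IsNecessity 𝒜 N) :
    ∃ (m : ℕ) (C : Fin m ≃ atoms 𝒜) (w : Fin m → ℝ), (∀ k, 0 ≤ w k) ∧ ∑ k, w k = 1 ∧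
      ∀ A ∈ 𝒜, ∑ k, minInd (⋃ j ≤ k, (C j : Set Ω)) A * w k = N A := by
  classical
  have := hfin.fintype
  let C₀ : Fin (Fintype.card (atoms 𝒜)) ≃ atoms 𝒜 := (Fintype.equivFin _).symm
  set m := Fintype.card (atoms 𝒜)
  let C : Fin m ≃ atoms 𝒜 := (Tuple.sort fun i => N (C₀ i : Set Ω)ᶜ).trans C₀
  have hmono : Monotone fun i => N (C i : Set Ω)ᶜ :=
    Tuple.monotone_sort fun i => N (C₀ i : Set Ω)ᶜ
  have hC : ∀ i, (C i : Set Ω) ∈ 𝒜 := fun i => (minimal_of_mem_atoms (C i).2).prop.1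
  let U : ℕ → Set Ω := fun n => ⋃ j ∈ Finset.univ.filter fun j : Fin m => j.val < n, (C j : Set Ω)
  have memU : ∀ {n ω}, ω ∈ U n ↔ ∃ j : Fin m, j.val < n ∧ ω ∈ (C j : Set Ω) := by
    intro n ω
    simp [U]
  have hU : ∀ n, U n ∈ 𝒜 := fun n => h𝒜.biUnion_mem _ fun j _ => hC j
  have hUmono : ∀ n, U n ⊆ U (n + 1) := fun n ω hω => by
    obtain ⟨j, hj, h⟩ := memU.1 hω
    exact memU.2 ⟨j, by omega, h⟩
  have hU0 : U 0 = ∅ := by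
    ext ω
    simp [memU]
  have hUm : U m = Set.univ := by
    refine eq_univ_of_forall fun ω => ?_
    obtain ⟨D, hD, hω⟩ : ω ∈ ⋃₀ atoms 𝒜 := by rw [hcov]; trivial
    refine memU.2 ⟨C.symm ⟨D, hD⟩, (C.symm ⟨D, hD⟩).2, by simpa using hω⟩
  have hUsucc : ∀ k : Fin m, U k = U (k + 1) ∩ (C k : Set Ω)ᶜ := by
    intro k
    ext ω
    constructor
    · intro hω
      refine ⟨hUmono _ hω, fun hk => ?_⟩
      obtain ⟨j, hj, h⟩ := memU.1 hω
      have hne : (C j : Set Ω) ≠ C k := fun h => hj.ne (by rw [C.injective (Subtype.ext h)])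
      exact disjoint_left.1 (disjoint_of_mem_atoms h𝒜 (C j).2 (C k).2 hne) h hk
    · rintro ⟨hω, hk⟩
      obtain ⟨j, hj, h⟩ := memU.1 hω
      refine memU.2 ⟨j, lt_of_le_of_ne (by omega) fun hjk => hk ?_, h⟩
      rwa [Fin.ext hjk] at h
  -- Because of the ordering, `N` of an initial union is `N` of the complement of the next atom.
  have hval : ∀ d, ∀ k : Fin m, k + 1 + d = m → N (U k) = N (C k : Set Ω)ᶜ := by
    intro d
    induction d with
    | zero =>
      intro k hk
      rw [hUsucc, hN.inter _ (hU _) _ (h𝒜.compl_mem (hC k)), show (k : ℕ) + 1 = m from hk, hUm,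
        hN.univ]
      exact min_eq_right (hN.mem_Icc _ (h𝒜.compl_mem (hC k))).2
    | succ d ih =>
      intro k hk
      have hlt : (k : ℕ) + 1 < m := by omega
      have hnext := ih ⟨k + 1, hlt⟩ (by simp only; omega)
      simp only at hnext
      rw [hUsucc, hN.inter _ (hU _) _ (h𝒜.compl_mem (hC k)), hnext]
      exact min_eq_right (hmono (Fin.le_def.2 (Nat.le_succ _)))
  have hstep : ∀ A ∈ 𝒜, ∀ k : Fin m, minInd (U (k + 1)) A * (N (U (k + 1)) - N (U k)) =
      N (A ∩ U (k + 1)) - N (A ∩ U k) := by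
    intro A hA k
    by_cases hsub : U (k + 1) ⊆ A
    · rw [inter_eq_self_of_subset_right hsub,
        inter_eq_self_of_subset_right ((hUmono k).trans hsub)]
      simp [minInd, hsub]
    · have hAk : N A ≤ N (U k) := by
        obtain ⟨ω, hω, hωA⟩ := not_subset.1 hsub
        obtain ⟨j, hj, h⟩ := memU.1 hω
        have hd : Disjoint A (C j : Set Ω) :=
          (subset_or_disjoint_of_mem_atoms h𝒜 (C j).2 hA).resolve_left fun hs => hωA (hs h)
        rw [hval (m - (k + 1)) k (by omega)]
        exact (hN.mono hA (h𝒜.compl_mem (hC j)) hd.subset_compl_right).trans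
          (hmono (Fin.le_def.2 (by omega)))
      have hAk' := hAk.trans (hN.mono (hU k) (hU (k + 1)) (hUmono k))
      rw [hN.inter _ hA _ (hU _), hN.inter _ hA _ (hU _), min_eq_left hAk, min_eq_left hAk']
      simp [minInd, hsub]
  have htel : ∀ A ∈ 𝒜, ∑ k : Fin m, minInd (U (k + 1)) A * (N (U (k + 1)) - N (U k)) = N A := by
    intro A hA
    rw [Finset.sum_congr rfl fun k _ => hstep A hA k,
      Fin.sum_univ_eq_sum_range (fun n => N (A ∩ U (n + 1)) - N (A ∩ U n)) m,
      Finset.sum_range_sub (fun n => N (A ∩ U n)), hU0, hUm, inter_univ, inter_empty, hN.empty,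
      sub_zero]
  have hchain : ∀ k : Fin m, ⋃ j ≤ k, (C j : Set Ω) = U (k + 1) := by
    intro k
    ext ω
    simp only [memU, mem_iUnion, exists_prop, Fin.le_def, Nat.lt_succ_iff]
  refine ⟨m, C, fun k => N (U (k + 1)) - N (U k), fun k => ?_, ?_, fun A hA => ?_⟩
  · exact sub_nonneg.2 (hN.mono (hU _) (hU _) (hUmono _))
  · have := htel Set.univ h𝒜.univ_mem
    simpa [minInd, hN.univ] using this
  · simp only [hchain]
    exact htel A hA

/-- Moves a mass function from an enumeration of a finite set, possibly with repetitions, to the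
set itself. -/
theorem exists_mass_of_range_eq {α κ : Type*} [Fintype κ] (s : Finset α) (D : κ → α)
    (hs : (s : Set α) = range D) (w : κ → ℝ) (hw : ∀ k, 0 ≤ w k) :
    ∃ x : s → ℝ, (∀ a, 0 ≤ x a) ∧ ∀ h : α → ℝ, ∑ a : s, h a * x a = ∑ k, h (D k) * w k := by
  classical
  have hD : ∀ k, D k ∈ s := fun k => by
    rw [← Finset.mem_coe, hs]
    exact mem_range_self k
  refine ⟨fun a => ∑ k with (⟨D k, hD k⟩ : s) = a, w k,
    fun a => Finset.sum_nonneg fun k _ => hw k, fun h => ?_⟩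
  rw [← Finset.sum_fiberwise Finset.univ fun k => (⟨D k, hD k⟩ : s)]
  refine Finset.sum_congr rfl fun a _ => ?_
  rw [Finset.mul_sum]
  refine Finset.sum_congr rfl fun k hk => ?_
  rw [← (Finset.mem_filter.1 hk).2]

theorem nonempty_of_mem_chain {𝒟 : Finset (Set Ω)} (h𝒟 : 𝒟 ∈ chains 𝒜) {D : Set Ω}
    (hD : D ∈ 𝒟) : D.Nonempty := by
  obtain ⟨m, C, hC⟩ := h𝒟
  rw [← Finset.mem_coe, hC] at hD
  obtain ⟨k, rfl⟩ := hD
  obtain ⟨ω, hω⟩ := (minimal_of_mem_atoms (C k).2).prop.2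
  exact ⟨ω, mem_iUnion₂.2 ⟨k, le_rfl, hω⟩⟩

theorem isChain_of_mem_chains {𝒟 : Finset (Set Ω)} (h𝒟 : 𝒟 ∈ chains 𝒜) :
    IsChain (· ⊆ ·) (𝒟 : Set (Set Ω)) := by
  obtain ⟨m, C, hC⟩ := h𝒟
  rw [hC]
  exact Monotone.isChain_range fun k l hkl =>
    biUnion_subset_biUnion_left fun j hj => le_trans hj hkl

/-- A mass function on a finite chain of non-empty events defines a necessity measure on all
events: the members of the chain contained in `A`, and those contained in `B`, are initial
segments of it, so one of the two families is contained in the other. -/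
theorem isNecessity_of_chain_mass {𝒟 : Finset (Set Ω)} (hne : ∀ D ∈ 𝒟, D.Nonempty)
    (hch : IsChain (· ⊆ ·) (𝒟 : Set (Set Ω))) (x : 𝒟 → ℝ) (hx : ∀ D, 0 ≤ x D)
    (hx1 : ∑ D, x D = 1) : IsNecessity Set.univ fun A => ∑ D : 𝒟, minInd (D : Set Ω) A * x D := by
  refine ⟨fun A _ => ⟨?_, ?_⟩, ?_, ?_, fun A _ B _ => ?_⟩
  · exact Finset.sum_nonneg fun D _ => mul_nonneg (minInd_mem_Icc _ _).1 (hx D)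
  · rw [← hx1]
    exact Finset.sum_le_sum fun D _ => mul_le_of_le_one_left (hx D) (minInd_mem_Icc _ _).2
  · refine Finset.sum_eq_zero fun D _ => ?_
    have : ¬ (D : Set Ω) ⊆ ∅ := fun h => (hne D D.2).ne_empty (subset_empty_iff.1 h)
    simp [minInd, this]
  · simpa [minInd] using hx1
  · have key : ∀ A B : Set Ω, (∀ D ∈ 𝒟, D ⊆ A → D ⊆ B) →
        ∑ D : 𝒟, minInd (D : Set Ω) (A ∩ B) * x D = min (∑ D : 𝒟, minInd (D : Set Ω) A * x D)
          (∑ D : 𝒟, minInd (D : Set Ω) B * x D) := by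
      intro A B h
      rw [min_eq_left]
      · refine Finset.sum_congr rfl fun D _ => ?_
        have : (D : Set Ω) ⊆ A ∩ B ↔ (D : Set Ω) ⊆ A :=
          ⟨fun hD => hD.trans inter_subset_left, fun hD => subset_inter hD (h D D.2 hD)⟩
        rw [minInd_congr this]
      · refine Finset.sum_le_sum fun D _ => mul_le_mul_of_nonneg_right ?_ (hx D)
        by_cases hD : (D : Set Ω) ⊆ A
        · simp [minInd, hD, h D D.2 hD]
        · simpa [minInd, hD] using (minInd_mem_Icc (D : Set Ω) B).1
    by_cases h : ∀ D ∈ 𝒟, D ⊆ A → D ⊆ B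
    · exact key A B h
    · rw [inter_comm, min_comm]
      refine key B A fun D hD hDB => ?_
      push Not at h
      obtain ⟨D', hD', hA, hB⟩ := h
      rcases hch.total hD hD' with hle | hle
      · exact hle.trans hA
      · exact absurd (hle.trans hDB) hB

end Chains

/-! ### Equivalence of the coherence conditions -/

section Coherence

variable {Ω : Type*} {𝓔 : Set (Set Ω)}

theorem IsNecessity.subset {𝒜 ℬ : Set (Set Ω)} {N : Set Ω → ℝ} (hN : IsNecessity ℬ N)
    (h : 𝒜 ⊆ ℬ) : IsNecessity 𝒜 N :=
  ⟨fun A hA => hN.mem_Icc A (h hA), hN.empty, hN.univ,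
    fun A hA B hB => hN.inter A (h hA) B (h hB)⟩

theorem Coherent1N.coherent3N {N : 𝓔 → Icc (0 : ℝ) 1} (h : Coherent1N N) : Coherent3N N := by
  classical
  obtain ⟨N', hN', hE⟩ := h
  intro ℱ _
  have hfin : ((fun E : 𝓔 => (E : Set Ω)) '' (ℱ : Set 𝓔)).Finite := ℱ.finite_toSet.image _
  have hsub : finAlgebra ℱ ⊆ algebra 𝓔 :=
    generateSetAlgebra_mono (by rintro _ ⟨E, -, rfl⟩; exact E.2)
  obtain ⟨m, C, w, hw, hw1, hwA⟩ := (hN'.subset hsub).exists_chain_mass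
    isSetAlgebra_generateSetAlgebra (atoms_finite hfin) (sUnion_atoms hfin)
  let D : Fin m → Set Ω := fun k => ⋃ j ≤ k, (C j : Set Ω)
  have hD : ((Finset.univ.image D : Finset (Set Ω)) : Set (Set Ω)) = range D := by simp
  obtain ⟨x, hx, hxw⟩ := exists_mass_of_range_eq _ D hD w hw
  refine ⟨Finset.univ.image D, ⟨m, C, hD⟩, x, fun E hE' => ?_, ?_, hx⟩
  · rw [hxw fun D => minInd D E, hE]
    exact hwA E (self_subset_generateSetAlgebra ⟨E, hE', rfl⟩)
  · simpa [hw1] using hxw fun _ => 1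

/-- On each finite subfamily the mass function extends the assessment to a necessity measure on
all events; a limit of these extensions along an ultrafilter of finite subfamilies, in the compact
space of all maps to `[0, 1]`, extends the whole assessment. -/
theorem Coherent3N.coherent1N (h𝓔 : 𝓔.Nonempty) {N : 𝓔 → Icc (0 : ℝ) 1} (h : Coherent3N N) :
    Coherent1N N := by
  classical
  obtain ⟨E₀, hE₀⟩ := h𝓔
  have hext : ∀ ℱ : Finset 𝓔, ∃ Φ : Set Ω → Icc (0 : ℝ) 1,
      IsNecessity Set.univ (fun A => (Φ A : ℝ)) ∧ ∀ E ∈ ℱ, Φ E = N E := by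
    intro ℱ
    obtain ⟨𝒟, h𝒟, x, hxE, hx1, hx⟩ := h (insert ⟨E₀, hE₀⟩ ℱ) (Finset.insert_nonempty _ _)
    have hnec := isNecessity_of_chain_mass (fun D hD => nonempty_of_mem_chain h𝒟 hD)
      (isChain_of_mem_chains h𝒟) x hx hx1
    exact ⟨fun A => ⟨_, hnec.mem_Icc A trivial⟩, hnec,
      fun E hE => Subtype.ext (hxE E (Finset.mem_insert_of_mem hE))⟩
  choose Φ hΦ hΦE using hext
  let u : Ultrafilter (Finset 𝓔) := Ultrafilter.of atTop
  obtain ⟨L, hL⟩ : ∃ L, Tendsto Φ u (𝓝 L) := ⟨_, (u.map Φ).le_nhds_lim⟩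
  have hlim : ∀ A, Tendsto (fun ℱ => (Φ ℱ A : ℝ)) u (𝓝 (L A : ℝ)) := fun A =>
    (continuous_subtype_val.tendsto _).comp (tendsto_pi_nhds.1 hL A)
  refine ⟨fun A => L A, ⟨fun A _ => (L A).2, ?_, ?_, fun A _ B _ => ?_⟩, fun E => ?_⟩
  · exact tendsto_nhds_unique (hlim ∅) (by simp [(hΦ _).empty])
  · exact tendsto_nhds_unique (hlim Set.univ) (by simp [(hΦ _).univ])
  · refine tendsto_nhds_unique (hlim (A ∩ B)) ?_
    simpa only [(hΦ _).inter A trivial B trivial] using (hlim A).min (hlim B)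
  · refine tendsto_nhds_unique (tendsto_const_nhds.congr' ?_) (hlim E)
    have : ∀ᶠ ℱ in (u : Filter (Finset 𝓔)), {E} ≤ ℱ :=
      Ultrafilter.of_le atTop (eventually_ge_atTop ({E} : Finset 𝓔))
    filter_upwards [this] with ℱ hℱ
    rw [hΦE ℱ E (Finset.singleton_subset_iff.1 hℱ)]

/-- The linear system of a chain expresses that the assessment is a convex combination of the
points `(minInd D E)_E`, for `D` in the chain. -/
theorem exists_mass_iff_mem_hull (N : 𝓔 → Icc (0 : ℝ) 1) (ℱ : Finset 𝓔) (𝒟 : Finset (Set Ω)) :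
    (∃ x : 𝒟 → ℝ, (∀ E ∈ ℱ, ∑ D : 𝒟, minInd (D : Set Ω) E * x D = N E) ∧
      ∑ D : 𝒟, x D = 1 ∧ ∀ D : 𝒟, 0 ≤ x D) ↔
    ∃ x : 𝒟 → ℝ, (∀ E : ℱ, ∑ D : 𝒟, minInd (D : Set Ω) (E : 𝓔) * x D = N E) ∧
      ∑ D : 𝒟, x D = 1 ∧ ∀ D : 𝒟, 0 ≤ x D := by
  simp only [Subtype.forall]

theorem nonempty_of_sum_eq_one {κ : Type*} [Fintype κ] {x : κ → ℝ} (hx : ∑ k, x k = 1) :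
    Nonempty κ := by
  by_contra h
  rw [not_nonempty_iff] at h
  simp at hx

theorem coherent3N_iff_coherent4N (N : 𝓔 → Icc (0 : ℝ) 1) : Coherent3N N ↔ Coherent4N N := by
  refine forall₂_congr fun ℱ _ => exists_congr fun 𝒟 => and_congr_right fun _ => ?_
  rw [exists_mass_iff_mem_hull]
  constructor
  · intro h
    have : Nonempty 𝒟 := nonempty_of_sum_eq_one h.choose_spec.2.1
    intro lam
    obtain ⟨D, hD⟩ := (mem_hull_iff_forall_exists_nonneg
      (fun (D : 𝒟) (E : ℱ) => minInd (D : Set Ω) (E : 𝓔)) fun E => N E).1 h lam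
    have hfin := 𝒟.finite_toSet.image (gain N ℱ lam)
    obtain ⟨M, hM⟩ := hfin.isCompact.exists_isGreatest ⟨_, D, D.2, rfl⟩
    exact ⟨M, hM, hD.trans (hM.2 ⟨D, D.2, rfl⟩)⟩
  · intro h
    have hD : ∀ lam, ∃ D : 𝒟, 0 ≤ gain N ℱ lam D := by
      intro lam
      obtain ⟨_, ⟨⟨D, hD, rfl⟩, -⟩, h0⟩ := h lam
      exact ⟨⟨D, hD⟩, h0⟩
    have : Nonempty 𝒟 := ⟨(hD 0).choose⟩
    exact (mem_hull_iff_forall_exists_nonneg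
      (fun (D : 𝒟) (E : ℱ) => minInd (D : Set Ω) (E : 𝓔)) fun E => N E).2 hD

theorem coherent3N_iff_coherent5N (N : 𝓔 → Icc (0 : ℝ) 1) : Coherent3N N ↔ Coherent5N N := by
  refine forall₂_congr fun ℱ hℱ => exists_congr fun 𝒟 => and_congr_right fun _ => ?_
  rw [exists_mass_iff_mem_hull]
  rcases isEmpty_or_nonempty 𝒟 with hempty | hne
  · -- Over an empty chain every other assessment would vacuously have a smaller penalty.
    refine iff_of_false (fun h => ?_) (fun h => h ?_)
    · exact not_nonempty_iff.2 hempty (nonempty_of_sum_eq_one h.choose_spec.2.1)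
    · have : Nonempty ℱ := hℱ.to_subtype
      obtain ⟨q, hq⟩ := exists_ne fun E : ℱ => N E
      exact ⟨q, hq, fun D hD => (hempty.false ⟨D, hD⟩).elim⟩
  · rw [mem_hull_iff_not_exists_closer
      (fun (D : 𝒟) (E : ℱ) => minInd (D : Set Ω) (E : 𝓔)) (fun _ _ => minInd_mem_Icc _ _)
      fun E => N E]
    simp only [Subtype.forall (p := (· ∈ 𝒟)), penalty]

end Coherence

end NecessityCoherence

end

theorem corollary2 {Ω : Type*} [Nonempty Ω] (𝓔 : Set (Set Ω)) (h𝓔 : 𝓔.Nonempty)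
    (N : 𝓔 → Set.Icc (0 : ℝ) 1) :
    List.TFAE [
      NecessityCoherence.Coherent1N N,
      NecessityCoherence.Coherent2N N,
      NecessityCoherence.Coherent3N N,
      NecessityCoherence.Coherent4N N,
      NecessityCoherence.Coherent5N N] := by
  tfae_have 1 ↔ 2 := NecessityCoherence.coherent1N_iff_coherent2N N
  tfae_have 1 → 3 := NecessityCoherence.Coherent1N.coherent3N
  tfae_have 3 → 1 := NecessityCoherence.Coherent3N.coherent1N h𝓔
  tfae_have 3 ↔ 4 := NecessityCoherence.coherent3N_iff_coherent4N N
  tfae_have 3 ↔ 5 := NecessityCoherence.coherent3N_iff_coherent5N N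
  tfae_finish
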